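/- **Canonical Decomposition Theorem.** Let $U$ be a finite set, and write $\bar X=U\setminus X$ for $X\subseteq U$. A *connectivity function* on $U$ is a map $\kappa:2^U\to\mathbb Z$ with $\kappa(\emptyset)=0$, $\kappa(X)=\kappa(\bar X)$ and $\kappa(X)+\kappa(Y)\ge\kappa(X\cap Y)+\kappa(X\cup Y)$ for all $X,Y\subseteq U$. A *$\kappa$-tangle* of order $k\ge 0$ is a family $\mathcal T\subseteq 2^U$, annotated with the integer $k=\operatorname{ord}(\mathcal T)$, such that (0) $\kappa(X)<k$ for all $X\in\mathcal T$; (1) for all $X\subseteq U$ with $\kappa(X)<k$, either $X\in\mathcal T$ or $\bar X\in\mathcal T$; (2) $X_1\cap X_2\cap X_3\ne\emptyset$ for all $X_1,X_2,X_3\in\mathcal T$; (3) $\{x\}\notin\mathcal T$ for all $x\in U$. A tangle $\mathcal T$ *extends* $\mathcal T'$ if $\mathcal T'\subseteq\mathcal T$ and $\operatorname{ord}(\mathcal T')\le\operatorname{ord}(\mathcal T)$; two tangles are *incomparable* if neither extends the other. A *$(\mathcal T,\mathcal T')$-separation* is a set $Z\subseteq U$ with $Z\in\mathcal T$ and $\bar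 Z\in\mathcal T'$; it is *minimum* if $\kappa(Z)$ is minimum among all $(\mathcal T,\mathcal T')$-separations. For a set $\mathfrak T$ of $\kappa$-tangles let $\mathfrak T_{\max}$ be the set of those elements of $\mathfrak T$ that are not properly extended by any element of $\mathfrak T$. A *nested set of separations* for $\mathfrak T$ is a set $\mathcal S\subseteq 2^U$ such that * for all $X,Y\in\mathcal S$: $X\subseteq Y$ or $X\subseteq\bar Y$ or $\bar X\subseteq Y$ or $\bar X\subseteq\bar Y$; * $\bar X\in\mathcal S$ for all $X\in\mathcal S$; * for all incomparable $\mathcal T,\mathcal T'\in\mathfrak T_{\max}$ there is a $Z\in\mathcal S$ that is a minimum $(\mathcal T,\mathcal T')$-separation; * for every $Z\in\mathcal S$ there are incomparable $\mathcal T,\mathcal T'\in\mathfrak T_{\max}$ such that $Z$ is a minimum $(\mathcal T,\mathcal T')$-separation. Then there is a canonical construction that associates with every finite set $U$, every connectivity function $\kappa$ on $U$ and every finite set $\mathfrak T$ of $\kappa$-tangles a nested set $\mathcal S(U,\kappa,\mathfrak T)$ of separations for $\mathfrak T$. Here *canonical* means the following: whenever $f:U\to U'$ is a bijection that is an isomorphism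 from $(U,\kappa,\mathfrak T)$ to $(U',\kappa',\mathfrak T')$, that is, $\kappa(X)=\kappa'(f(X))$ for all $X\subseteq U$, and $\mathfrak T'$ consists exactly of the tangles $\{f(X)\mid X\in\mathcal T\}$, with order $\operatorname{ord}(\mathcal T)$, for $\mathcal T\in\mathfrak T$, then for all $Z\subseteq U$ we have $Z\in\mathcal S(U,\kappa,\mathfrak T)$ if and only if $f(Z)\in\mathcal S(U',\kappa',\mathfrak T')$. -/

import Mathlib

universe u

/-- A connectivity function on `U`: a normalised, symmetric and submodular integer-valued
function on the subsets of `U`. -/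
structure ConnectivityFunction (U : Type*) where
  toFun : Set U → ℤ
  normalised : toFun ∅ = 0
  symmetric : ∀ X : Set U, toFun Xᶜ = toFun X
  submodular : ∀ X Y : Set U, toFun (X ∩ Y) + toFun (X ∪ Y) ≤ toFun X + toFun Y

instance {U : Type*} : CoeFun (ConnectivityFunction U) (fun _ => Set U → ℤ) :=
  ⟨ConnectivityFunction.toFun⟩

/-- A `κ`-tangle, annotated with its order: a pair of a family `sets` of subsets of `U` and an
order `ord`. (The family alone does not always determine the order.) -/
@[ext]
structure Tangle {U : Type*} (κ : ConnectivityFunction U) where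
  sets : Set (Set U)
  ord : ℕ
  lt_ord : ∀ X ∈ sets, κ X < (ord : ℤ)
  mem_or_compl_mem : ∀ X : Set U, κ X < (ord : ℤ) → X ∈ sets ∨ Xᶜ ∈ sets
  inter_nonempty : ∀ X ∈ sets, ∀ Y ∈ sets, ∀ Z ∈ sets, (X ∩ Y ∩ Z).Nonempty
  singleton_notMem : ∀ x : U, {x} ∉ sets

namespace Tangle

variable {U : Type*} {κ : ConnectivityFunction U}

/-- `T' ≤ T` means that `T` is an extension of `T'`. The condition on the orders matters only for
tangles with the same underlying family, where the one of larger order is the extension. -/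
instance : PartialOrder (Tangle κ) where
  le T' T := T'.sets ⊆ T.sets ∧ T'.ord ≤ T.ord
  le_refl _ := ⟨subset_rfl, le_rfl⟩
  le_trans _ _ _ h h' := ⟨h.1.trans h'.1, h.2.trans h'.2⟩
  le_antisymm _ _ h h' := Tangle.ext (h.1.antisymm h'.1) (h.2.antisymm h'.2)

/-- Two tangles are incomparable if neither is an extension of the other. -/
def Incomparable (T T' : Tangle κ) : Prop := ¬ T ≤ T' ∧ ¬ T' ≤ T

/-- `Z` is a `(T, T')`-separation. -/
def IsSeparation (T T' : Tangle κ) (Z : Set U) : Prop := Z ∈ T.sets ∧ Zᶜ ∈ T'.sets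

/-- `Z` is a minimum `(T, T')`-separation: a `(T, T')`-separation of minimum order. -/
def IsMinSeparation (T T' : Tangle κ) (Z : Set U) : Prop :=
  IsSeparation T T' Z ∧ ∀ W : Set U, IsSeparation T T' W → κ Z ≤ κ W

end Tangle

/-- Two subsets of `U` are nested (that is, they do not cross). -/
def NestedSets {U : Type*} (X Y : Set U) : Prop :=
  X ⊆ Y ∨ X ⊆ Yᶜ ∨ Xᶜ ⊆ Y ∨ Xᶜ ⊆ Yᶜ

/-- `S` is a nested set of separations for `F`, a family of mutually incomparable tangles. -/
structure IsNestedSetForIncomparable {U : Type*} {κ : ConnectivityFunction U}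
    (F : Set (Tangle κ)) (S : Set (Set U)) : Prop where
  nested : ∀ X ∈ S, ∀ Y ∈ S, NestedSets X Y
  compl_mem : ∀ X ∈ S, Xᶜ ∈ S
  exists_min_separation : ∀ T ∈ F, ∀ T' ∈ F, T.Incomparable T' →
    ∃ Z ∈ S, T.IsMinSeparation T' Z
  is_min_separation : ∀ Z ∈ S, ∃ T ∈ F, ∃ T' ∈ F, T.Incomparable T' ∧ T.IsMinSeparation T' Z

/-- `S` is a nested set of separations for an arbitrary family `F` of tangles: a nested set of
separations for the family of all maximal elements of `F`. -/
def IsNestedSetOfSeparations {U : Type*} {κ : ConnectivityFunction U}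
    (F : Set (Tangle κ)) (S : Set (Set U)) : Prop :=
  IsNestedSetForIncomparable {T | Maximal (fun T' => T' ∈ F) T} S

/-- The bijection `f : U ≃ U'` maps the tangle `T` to the tangle `T'` (of the same order). -/
def Tangle.MapsTo {U U' : Type*} {κ : ConnectivityFunction U} {κ' : ConnectivityFunction U'}
    (f : U ≃ U') (T : Tangle κ) (T' : Tangle κ') : Prop :=
  T.ord = T'.ord ∧ ∀ X : Set U, X ∈ T.sets ↔ f '' X ∈ T'.sets

/-- The bijection `f : U ≃ U'` is an isomorphism from `(U, κ, F)` to `(U', κ', F')`, where `F` and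
`F'` are sets of tangles: it preserves the connectivity function and maps `F` onto `F'`. -/
structure IsTangleFamilyIso {U U' : Type*} {κ : ConnectivityFunction U}
    {κ' : ConnectivityFunction U'} (f : U ≃ U') (F : Set (Tangle κ)) (F' : Set (Tangle κ')) :
    Prop where
  map_conn : ∀ X : Set U, κ X = κ' (f '' X)
  forth : ∀ T ∈ F, ∃ T' ∈ F', Tangle.MapsTo f T T'
  back : ∀ T' ∈ F', ∃ T ∈ F, Tangle.MapsTo f T T'

/-! Separations are chosen order by order. At order `k`, for each incomparable pair whose minimum
separations have order `k`, take all those minimum separations that cross nothing chosen at smaller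
orders and, among these, minimise the weight `|Z| * |Zᶜ|`. No tie is ever broken, so the choice
commutes with isomorphisms.

Two facts make this work. Candidates exist: a minimum separation crossing a chosen `Y` of smaller
order can be replaced by a corner that no longer crosses `Y` and gains no new crossing
(`IsMinSeparation.exists_corner`, via the triple intersection axiom in
`IsMinSeparation.not_corners_lt`). Choices of equal order do not cross each other
(`IsExtremeSeparation.nestedSets`): submodularity of `κ` would make two opposite corners minimum
separations again, while the weight is strictly submodular on crossing pairs, so one of these
corners would be too light. -/

namespace ConnectivityFunction

variable {U : Type*} (κ : ConnectivityFunction U)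

theorem nonneg (X : Set U) : 0 ≤ κ X := by
  have h := κ.submodular X Xᶜ
  have h0 := κ.symmetric ∅
  have hX := κ.symmetric X
  rw [Set.inter_compl_self, Set.union_compl_self] at h
  rw [Set.compl_empty] at h0
  have hn := κ.normalised
  omega

end ConnectivityFunction

/-! ### Nested and crossing sets -/

namespace NestedSets

variable {U : Type*} {X Y Z : Set U}

theorem symm (h : NestedSets X Y) : NestedSets Y X := by
  rcases h with h | h | h | h
  · exact Or.inr (Or.inr (Or.inr (Set.compl_subset_compl.2 h)))
  · exact Or.inr (Or.inl (Set.subset_compl_comm.1 h))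
  · exact Or.inr (Or.inr (Or.inl (Set.compl_subset_comm.1 h)))
  · exact Or.inl (Set.compl_subset_compl.1 h)

theorem compl_left (h : NestedSets X Y) : NestedSets Xᶜ Y := by
  unfold NestedSets at *
  rw [compl_compl]
  tauto

theorem compl_left_iff : NestedSets Xᶜ Y ↔ NestedSets X Y :=
  ⟨fun h => compl_compl X ▸ h.compl_left, compl_left⟩

theorem compl_right_iff : NestedSets X Yᶜ ↔ NestedSets X Y :=
  ⟨fun h => (compl_left_iff.1 h.symm).symm, fun h => h.symm.compl_left.symm⟩

/-- A set nested with two crossing sets is nested with their intersection. -/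
theorem inter_left (hXY : ¬ NestedSets X Y) (hX : NestedSets X Z) (hY : NestedSets Y Z) :
    NestedSets (X ∩ Y) Z := by
  rcases hX with h | h | h | h
  · exact Or.inl (Set.inter_subset_left.trans h)
  · exact Or.inr (Or.inl (Set.inter_subset_left.trans h))
  · rcases hY with h' | h' | h' | h'
    · exact Or.inl (Set.inter_subset_right.trans h')
    · exact Or.inr (Or.inl (Set.inter_subset_right.trans h'))
    · exact Or.inr (Or.inr (Or.inl (by rw [Set.compl_inter]; exact Set.union_subset h h')))
    -- In the mixed cases `Z` or its complement lies between `Xᶜ` and `Y`, so `X` and `Y` would not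
    -- cross.
    · exact absurd (Or.inr (Or.inr (Or.inl (h.trans (Set.compl_subset_compl.1 h'))))) hXY
  · rcases hY with h' | h' | h' | h'
    · exact Or.inl (Set.inter_subset_right.trans h')
    · exact Or.inr (Or.inl (Set.inter_subset_right.trans h'))
    · exact absurd (Or.inr (Or.inr (Or.inl (h.trans (Set.compl_subset_comm.1 h'))))) hXY
    · exact Or.inr (Or.inr (Or.inr (by rw [Set.compl_inter]; exact Set.union_subset h h')))

/-- A set nested with two crossing sets is nested with their union. -/
theorem union_left (hXY : ¬ NestedSets X Y) (hX : NestedSets X Z) (hY : NestedSets Y Z) :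
    NestedSets (X ∪ Y) Z := by
  rw [← compl_left_iff, Set.compl_union]
  exact inter_left (by rwa [compl_left_iff, compl_right_iff]) hX.compl_left hY.compl_left

theorem inter_self_right : NestedSets (X ∩ Y) Y := Or.inl Set.inter_subset_right

theorem image_iff {U' : Type*} (f : U ≃ U') :
    NestedSets (f '' X) (f '' Y) ↔ NestedSets X Y := by
  unfold NestedSets
  simp only [← Set.image_compl_eq f.bijective, Set.image_subset_image_iff f.injective]

end NestedSets

/-! ### Strict submodularity of the weight -/

/-- The product of the cardinalities of the two sides of a separation. -/
noncomputable def sepWeight {U : Type*} (X : Set U) : ℕ := X.ncard * Xᶜ.ncard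

theorem sepWeight_compl {U : Type*} (X : Set U) : sepWeight Xᶜ = sepWeight X := by
  rw [sepWeight, sepWeight, compl_compl, mul_comm]

theorem sepWeight_image {U U' : Type*} (f : U ≃ U') (X : Set U) :
    sepWeight (f '' X) = sepWeight X := by
  rw [sepWeight, sepWeight, ← Set.image_compl_eq f.bijective,
    Set.ncard_image_of_injective _ f.injective, Set.ncard_image_of_injective _ f.injective]

theorem sepWeight_inter_add_union_lt {U : Type*} [Finite U] {X Y : Set U}
    (h : ¬ NestedSets X Y) :
    sepWeight (X ∩ Y) + sepWeight (X ∪ Y) < sepWeight X + sepWeight Y := by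
  have h1 : (X \ Y).Nonempty := by
    rw [Set.sdiff_nonempty]; exact fun h' => h (Or.inl h')
  have h2 : (Y \ X).Nonempty := by
    rw [Set.sdiff_nonempty]; exact fun h' => h (NestedSets.symm (Or.inl h'))
  have p1 := (Set.ncard_pos (Set.toFinite _)).2 h1
  have p2 := (Set.ncard_pos (Set.toFinite _)).2 h2
  have e1 := Set.ncard_inter_add_ncard_sdiff_eq_ncard X Y (Set.toFinite _)
  have e2 := Set.ncard_inter_add_ncard_sdiff_eq_ncard Y X (Set.toFinite _)
  have e3 := Set.ncard_union_add_ncard_inter X Y (Set.toFinite _) (Set.toFinite _)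
  rw [Set.inter_comm] at e2
  have c (W : Set U) := Set.ncard_add_ncard_compl W (Set.toFinite _) (Set.toFinite _)
  have c1 := c X
  have c2 := c Y
  have c3 := c (X ∩ Y)
  have c4 := c (X ∪ Y)
  unfold sepWeight
  generalize (X ∩ Y).ncard = i at *
  generalize (X ∪ Y).ncard = u at *
  generalize (X \ Y).ncard = p at *
  generalize (Y \ X).ncard = q at *
  generalize (X ∪ Y)ᶜ.ncard = r at *
  obtain rfl : u = i + p + q := by omega
  obtain hx : X.ncard = i + p := by omega
  obtain hy : Y.ncard = i + q := by omega
  obtain hx' : Xᶜ.ncard = r + q := by omega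
  obtain hy' : Yᶜ.ncard = r + p := by omega
  obtain hi : (X ∩ Y)ᶜ.ncard = r + p + q := by omega
  rw [hx, hy, hx', hy', hi]
  -- The right side exceeds the left by exactly `2 * p * q`.
  have := Nat.mul_pos p1 p2
  nlinarith

/-! ### Tangles and minimum separations -/

namespace Tangle

variable {U : Type*} {κ : ConnectivityFunction U} {T T' T₁ T₂ T₃ T₄ : Tangle κ} {X Y Z : Set U}

theorem disjoint_notMem (hX : X ∈ T.sets) (h : X ∩ Y = ∅) : Y ∉ T.sets := fun hY => by
  have := T.inter_nonempty X hX Y hY Y hY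
  rw [h, Set.empty_inter] at this
  exact Set.not_nonempty_empty this

theorem mem_of_superset (hX : X ∈ T.sets) (h : X ⊆ Y) (hY : κ Y < T.ord) : Y ∈ T.sets :=
  (T.mem_or_compl_mem Y hY).resolve_right
    (disjoint_notMem hX (by rw [← Set.sdiff_eq, Set.sdiff_eq_empty.2 h]))

theorem inter_mem (hX : X ∈ T.sets) (hY : Y ∈ T.sets) (h : κ (X ∩ Y) < T.ord) :
    X ∩ Y ∈ T.sets :=
  (T.mem_or_compl_mem _ h).resolve_right fun hc => by
    have := T.inter_nonempty X hX Y hY _ hc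
    rw [Set.inter_compl_self] at this
    exact Set.not_nonempty_empty this

theorem IsSeparation.symm (h : T.IsSeparation T' Z) : T'.IsSeparation T Zᶜ :=
  ⟨h.2, by rw [compl_compl]; exact h.1⟩

theorem IsMinSeparation.symm (h : T.IsMinSeparation T' Z) : T'.IsMinSeparation T Zᶜ :=
  ⟨h.1.symm, fun W hW => by
    have := h.2 _ hW.symm
    rwa [κ.symmetric] at this ⊢⟩

theorem IsSeparation.lt_ord_left (h : T.IsSeparation T' Z) : κ Z < T.ord := T.lt_ord _ h.1

theorem IsSeparation.lt_ord_right (h : T.IsSeparation T' Z) : κ Z < T'.ord := by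
  simpa only [κ.symmetric] using T'.lt_ord _ h.2

theorem Incomparable.symm (h : T.Incomparable T') : T'.Incomparable T := ⟨h.2, h.1⟩

/-- The tangle of smaller order has a member missing from the other one, which is of large enough
order to contain the complement. -/
theorem Incomparable.exists_isSeparation (h : T.Incomparable T') :
    ∃ Z, T.IsSeparation T' Z := by
  have key : ∀ {R R' : Tangle κ}, R.Incomparable R' → R.ord ≤ R'.ord →
      ∃ Z, R.IsSeparation R' Z := fun {R R'} h ho => by
    have : ¬ R.sets ⊆ R'.sets := fun hs => h.1 ⟨hs, ho⟩
    obtain ⟨X, hX, hX'⟩ := Set.not_subset.1 this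
    have hlt := R.lt_ord X hX
    exact ⟨X, hX, (R'.mem_or_compl_mem X (by omega)).resolve_left hX'⟩
  rcases le_total T.ord T'.ord with ho | ho
  · exact key h ho
  · obtain ⟨Z, hZ⟩ := key h.symm ho
    exact ⟨Zᶜ, hZ.symm⟩

theorem Incomparable.exists_isMinSeparation [Finite U] (h : T.Incomparable T') :
    ∃ Z, T.IsMinSeparation T' Z := by
  obtain ⟨Z, hZ, hmin⟩ := Set.exists_min_image {Z | T.IsSeparation T' Z} κ (Set.toFinite _)
    h.exists_isSeparation
  exact ⟨Z, hZ, hmin⟩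

/-- Shrinking `X` keeps the complement in `T'` as soon as the order permits, so only membership in
`T` needs `Y ∈ T.sets`. -/
theorem IsMinSeparation.inter (h : T.IsMinSeparation T' X) (hY : Y ∈ T.sets)
    (hle : κ (X ∩ Y) ≤ κ X) : T.IsMinSeparation T' (X ∩ Y) := by
  have h1 := h.1.lt_ord_left
  have h2 := h.1.lt_ord_right
  refine ⟨⟨inter_mem h.1.1 hY (by omega), mem_of_superset h.1.2
    (Set.compl_subset_compl.2 Set.inter_subset_left) ?_⟩, fun W hW => hle.trans (h.2 W hW)⟩
  rw [κ.symmetric]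
  omega

theorem IsMinSeparation.le_inter (h : T.IsMinSeparation T' X) (hY : Y ∈ T.sets) :
    κ X ≤ κ (X ∩ Y) := by
  rcases le_total (κ X) (κ (X ∩ Y)) with hle | hle
  · exact hle
  · exact h.2 _ (h.inter hY hle).1

theorem IsMinSeparation.union (h : T.IsMinSeparation T' X) (hY : Yᶜ ∈ T'.sets)
    (hle : κ (X ∪ Y) ≤ κ X) : T.IsMinSeparation T' (X ∪ Y) := by
  have := (h.symm.inter hY
    (by rw [← Set.compl_union, κ.symmetric, κ.symmetric]; exact hle)).symm
  rwa [← Set.compl_union, compl_compl] at this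

theorem IsMinSeparation.le_union (h : T.IsMinSeparation T' X) (hY : Yᶜ ∈ T'.sets) :
    κ X ≤ κ (X ∪ Y) := by
  have := h.symm.le_inter hY
  rwa [← Set.compl_union, κ.symmetric, κ.symmetric] at this

/-- A set `X` cannot split the far side of a minimum separation `Y` into two parts of order less
than that of `Y`. -/
theorem IsMinSeparation.not_corners_lt (h : T.IsMinSeparation T' Y)
    (h₁ : κ (X ∩ Yᶜ) < κ Y) (h₂ : κ (Xᶜ ∩ Yᶜ) < κ Y) : False := by
  have o := h.1.lt_ord_left
  have o' := h.1.lt_ord_right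
  have key : ∀ W : Set U, κ (W ∩ Yᶜ) < κ Y → (W ∩ Yᶜ)ᶜ ∈ T'.sets := fun W hW => by
    -- If `T'` contained the corner, the corner's complement would separate `T` from `T'` at an
    -- order below the minimum.
    refine (T'.mem_or_compl_mem (W ∩ Yᶜ) (by omega)).resolve_left fun hm => ?_
    have hs : T.IsSeparation T' (W ∩ Yᶜ)ᶜ := by
      refine ⟨mem_of_superset h.1.1 ?_ (by rw [κ.symmetric]; omega), by rwa [compl_compl]⟩
      rw [Set.subset_compl_comm]
      exact Set.inter_subset_right
    have := h.2 _ hs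
    rw [κ.symmetric] at this
    omega
  -- The two corners cover `Yᶜ`, so these three members of `T'` have no common point.
  obtain ⟨x, ⟨hx, hx1⟩, hx2⟩ := T'.inter_nonempty _ h.1.2 _ (key X h₁) _ (key Xᶜ h₂)
  by_cases hX : x ∈ X
  · exact hx1 ⟨hX, hx⟩
  · exact hx2 ⟨hX, hx⟩

/-! ### Extreme separations of equal order -/

/-- `Z` is a minimum separation that crosses no member of `N`. -/
def IsMinSeparationNested (N : Set (Set U)) (T T' : Tangle κ) (Z : Set U) : Prop :=
  T.IsMinSeparation T' Z ∧ ∀ Y ∈ N, NestedSets Z Y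

/-- `Z` is a least balanced minimum separation among those that cross no member of `N`. -/
def IsExtremeSeparation (N : Set (Set U)) (T T' : Tangle κ) (Z : Set U) : Prop :=
  IsMinSeparationNested N T T' Z ∧
    ∀ W, IsMinSeparationNested N T T' W → sepWeight Z ≤ sepWeight W

variable {N : Set (Set U)}

theorem IsMinSeparationNested.symm (h : IsMinSeparationNested N T T' Z) :
    IsMinSeparationNested N T' T Zᶜ :=
  ⟨h.1.symm, fun Y hY => (h.2 Y hY).compl_left⟩

theorem IsExtremeSeparation.symm (h : IsExtremeSeparation N T T' Z) :
    IsExtremeSeparation N T' T Zᶜ :=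
  ⟨h.1.symm, fun W hW => by
    have := h.2 _ hW.symm
    rwa [sepWeight_compl] at this ⊢⟩

theorem IsMinSeparationNested.exists_isExtremeSeparation [Finite U]
    (h : IsMinSeparationNested N T T' Z) : ∃ W, IsExtremeSeparation N T T' W := by
  obtain ⟨W, hW, hmin⟩ := Set.exists_min_image {Z | IsMinSeparationNested N T T' Z} sepWeight
    (Set.toFinite _) ⟨Z, h⟩
  exact ⟨W, hW, hmin⟩

/-- Otherwise `X ∩ Y` and `X ∪ Y` would be competitors of `Y` and of `X` respectively, with total
weight too small. -/
theorem IsExtremeSeparation.uncross [Finite U] (hX : IsExtremeSeparation N T₁ T₂ X)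
    (hY : IsExtremeSeparation N T₃ T₄ Y) (hκ : κ X = κ Y) (hXY : ¬ NestedSets X Y)
    (h₂ : Yᶜ ∈ T₂.sets) : X ∉ T₃.sets := fun h₃ => by
  have i := hY.1.1.le_inter h₃
  have u := hX.1.1.le_union h₂
  rw [Set.inter_comm] at i
  have s := κ.submodular X Y
  have hi : IsMinSeparationNested N T₃ T₄ (X ∩ Y) :=
    ⟨Set.inter_comm Y X ▸ hY.1.1.inter h₃ (by rw [Set.inter_comm]; omega),
      fun W hW => NestedSets.inter_left hXY (hX.1.2 W hW) (hY.1.2 W hW)⟩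
  have hu : IsMinSeparationNested N T₁ T₂ (X ∪ Y) :=
    ⟨hX.1.1.union h₂ (by omega),
      fun W hW => NestedSets.union_left hXY (hX.1.2 W hW) (hY.1.2 W hW)⟩
  have := hY.2 _ hi
  have := hX.2 _ hu
  have := sepWeight_inter_add_union_lt hXY
  omega

/-- Both corners compete with `X` for the same pair `T₁`, `T₂`, so twice the weight of `X` is below
the sum of the two weights. -/
theorem IsExtremeSeparation.sepWeight_lt [Finite U] (hX : IsExtremeSeparation N T₁ T₂ X)
    (hY : ∀ W ∈ N, NestedSets Y W) (hκ : κ X = κ Y) (hXY : ¬ NestedSets X Y)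
    (h : T₁.IsSeparation T₂ Y) : sepWeight X < sepWeight Y := by
  have i := hX.1.1.le_inter h.1
  have u := hX.1.1.le_union h.2
  have s := κ.submodular X Y
  have hi : IsMinSeparationNested N T₁ T₂ (X ∩ Y) :=
    ⟨hX.1.1.inter h.1 (by omega),
      fun W hW => NestedSets.inter_left hXY (hX.1.2 W hW) (hY W hW)⟩
  have hu : IsMinSeparationNested N T₁ T₂ (X ∪ Y) :=
    ⟨hX.1.1.union h.2 (by omega),
      fun W hW => NestedSets.union_left hXY (hX.1.2 W hW) (hY W hW)⟩
  have := hX.2 _ hi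
  have := hX.2 _ hu
  have := sepWeight_inter_add_union_lt hXY
  omega

/-- Extreme separations of the same order are nested. -/
theorem IsExtremeSeparation.nestedSets [Finite U] (hX : IsExtremeSeparation N T₁ T₂ X)
    (hY : IsExtremeSeparation N T₃ T₄ Y) (hκ : κ X = κ Y) : NestedSets X Y := by
  by_contra hXY
  have hXY' : ¬ NestedSets X Yᶜ := by rwa [NestedSets.compl_right_iff]
  have hYX : ¬ NestedSets Y X := fun h => hXY h.symm
  have hYX' : ¬ NestedSets Y Xᶜ := by rwa [NestedSets.compl_right_iff]
  have hκX := κ.symmetric X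
  have hκY := κ.symmetric Y
  have a1 := hX.1.1.1.lt_ord_left
  have a2 := hX.1.1.1.lt_ord_right
  have a3 := hY.1.1.1.lt_ord_left
  have a4 := hY.1.1.1.lt_ord_right
  have d1 := T₁.mem_or_compl_mem Y (by omega)
  have d2 := T₂.mem_or_compl_mem Y (by omega)
  have d3 := T₃.mem_or_compl_mem X (by omega)
  have d4 := T₄.mem_or_compl_mem X (by omega)
  have n1 : Yᶜ ∈ T₂.sets → X ∉ T₃.sets := hX.uncross hY hκ hXY
  have n2 : Y ∈ T₂.sets → X ∉ T₄.sets := fun h =>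
    hX.uncross hY.symm (by omega) hXY' (by rwa [compl_compl])
  have n3 : Yᶜ ∈ T₁.sets → Xᶜ ∉ T₃.sets := fun h =>
    hX.symm.uncross hY (by omega) (by rwa [NestedSets.compl_left_iff]) h
  have n4 : Xᶜ ∈ T₄.sets → Y ∉ T₁.sets := hY.uncross hX hκ.symm hYX
  -- Either orientation of `Y` in `T₁` forces all the others: `Y` or `Yᶜ` separates `T₁` from `T₂`,
  -- and `X` or `Xᶜ` separates `T₃` from `T₄`. Each weight is then strictly below the other.
  by_cases h1 : Y ∈ T₁.sets
  · have h4 : X ∈ T₄.sets := d4.resolve_right fun h => n4 h h1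
    have h2 : Yᶜ ∈ T₂.sets := d2.resolve_left fun h => n2 h h4
    have h3 : Xᶜ ∈ T₃.sets := d3.resolve_left (n1 h2)
    have w1 := hX.sepWeight_lt hY.1.2 hκ hXY ⟨h1, h2⟩
    have w2 := hY.sepWeight_lt hX.symm.1.2 (by omega) hYX' ⟨h3, by rwa [compl_compl]⟩
    rw [sepWeight_compl] at w2
    omega
  · have h1' : Yᶜ ∈ T₁.sets := d1.resolve_left h1
    have h3 : X ∈ T₃.sets := d3.resolve_right (n3 h1')
    have h2 : Y ∈ T₂.sets := d2.resolve_right fun h => n1 h h3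
    have h4 : Xᶜ ∈ T₄.sets := d4.resolve_left (n2 h2)
    have w1 := hX.sepWeight_lt hY.symm.1.2 (by omega) hXY' ⟨h1', by rwa [compl_compl]⟩
    have w2 := hY.sepWeight_lt hX.1.2 hκ.symm hYX ⟨h3, h4⟩
    rw [sepWeight_compl] at w1
    omega

/-! ### Avoiding separations of smaller order -/

/-- Uncrossing a minimum separation `X` with a separation `Y` of smaller order. -/
theorem IsMinSeparation.exists_corner (hX : T.IsMinSeparation T' X)
    (hY : T₃.IsMinSeparation T₄ Y) (hκ : κ Y < κ X) (hXY : ¬ NestedSets X Y) :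
    ∃ W, T.IsMinSeparation T' W ∧ NestedSets W Y ∧
      ∀ V, NestedSets X V → NestedSets Y V → NestedSets W V := by
  have key : ∀ {R R' : Tangle κ} {Y : Set U}, R.IsMinSeparation R' Y → κ Y < κ X →
      ¬ NestedSets X Y → Y ∈ T.sets → Y ∈ T'.sets →
      ∃ W, T.IsMinSeparation T' W ∧ NestedSets W Y ∧
        ∀ V, NestedSets X V → NestedSets Y V → NestedSets W V := by
    intro R R' Y hY hκ hXY h h'
    by_cases h1 : κ (X ∩ Y) ≤ κ X
    · exact ⟨_, hX.inter h h1, NestedSets.inter_self_right,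
        fun V hV hV' => NestedSets.inter_left hXY hV hV'⟩
    by_cases h2 : κ (Xᶜ ∩ Y) ≤ κ Xᶜ
    · refine ⟨(Xᶜ ∩ Y)ᶜ, (hX.symm.inter h' h2).symm,
        NestedSets.inter_self_right.compl_left, fun V hV hV' => ?_⟩
      exact (NestedSets.inter_left (by rwa [NestedSets.compl_left_iff])
        hV.compl_left hV').compl_left
    have s1 := κ.submodular X Y
    have s2 := κ.submodular Xᶜ Y
    have e1 := κ.symmetric (X ∪ Y)
    have e2 := κ.symmetric (Xᶜ ∪ Y)
    have e3 := κ.symmetric X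
    rw [Set.compl_union] at e1 e2
    rw [compl_compl] at e2
    -- If both corners inside `Y` exceed `κ X`, submodularity puts both corners inside `Yᶜ` below `κ
    -- Y`.
    exact (hY.not_corners_lt (X := X) (by omega) (by omega)).elim
  have o := hX.1.lt_ord_left
  have o' := hX.1.lt_ord_right
  have hκY := κ.symmetric Y
  have d := T.mem_or_compl_mem Y (by omega)
  have d' := T'.mem_or_compl_mem Y (by omega)
  -- The order of `Y` is too small to separate `T` from `T'`, so both tangles contain the same side
  -- of `Y`.
  have n1 : ¬ (Y ∈ T.sets ∧ Yᶜ ∈ T'.sets) := fun h => by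
    have := hX.2 Y h
    omega
  have n2 : ¬ (Yᶜ ∈ T.sets ∧ Y ∈ T'.sets) := fun h => by
    have := hX.2 Yᶜ ⟨h.1, by rw [compl_compl]; exact h.2⟩
    omega
  by_cases h : Y ∈ T.sets
  · exact key hY hκ hXY h (by tauto)
  · obtain ⟨W, hW, hWY, hV⟩ := key hY.symm (by omega)
      (by rwa [NestedSets.compl_right_iff]) (by tauto) (by tauto)
    exact ⟨W, hW, NestedSets.compl_right_iff.1 hWY, fun V h1 h2 => hV V h1 h2.compl_left⟩

/-- A nested set of minimum separations of small order can be avoided by a minimum separation. -/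
theorem IsMinSeparation.exists_isMinSeparationNested [Finite U] (hX : T.IsMinSeparation T' X)
    (hN : ∀ Y ∈ N, ∀ Z ∈ N, NestedSets Y Z)
    (hlt : ∀ Y ∈ N, κ Y < κ X ∧ ∃ R R' : Tangle κ, R.IsMinSeparation R' Y) :
    ∃ W, IsMinSeparationNested N T T' W := by
  obtain ⟨W, hW, hmin⟩ := Set.exists_min_image {Z | T.IsMinSeparation T' Z}
    (fun Z => {Y ∈ N | ¬ NestedSets Z Y}.ncard) (Set.toFinite _) ⟨X, hX⟩
  refine ⟨W, hW, fun Y hY => ?_⟩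
  by_contra hWY
  obtain ⟨hκ, R, R', hR⟩ := hlt Y hY
  obtain ⟨V, hV, hVY, hVN⟩ := IsMinSeparation.exists_corner hW hR
    (hκ.trans_le (hX.2 _ hW.1)) hWY
  -- `V` crosses only members of `N` that `W` crosses, and no longer `Y`.
  refine absurd (hmin V hV) (not_le.2 (Set.ncard_lt_ncard ?_ (Set.toFinite _)))
  refine ⟨fun Z hZ => ⟨hZ.1, fun h => hZ.2 (hVN Z h (hN Y hY Z hZ.1))⟩, fun h => ?_⟩
  exact (h ⟨hY, hWY⟩ : Y ∈ N ∧ ¬ NestedSets V Y).2 hVY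

/-! ### The construction -/

/-- The canonical nested set of separations of order less than `k`. -/
def nestedBelow (F : Set (Tangle κ)) : ℕ → Set (Set U)
  | 0 => ∅
  | k + 1 => nestedBelow F k ∪ {Z | κ Z = k ∧ ∃ T ∈ F, ∃ T' ∈ F, T.Incomparable T' ∧
      IsExtremeSeparation (nestedBelow F k) T T' Z}

variable {F : Set (Tangle κ)}

theorem nestedBelow_spec {k : ℕ} (hZ : Z ∈ nestedBelow F k) :
    κ Z < k ∧ ∃ T ∈ F, ∃ T' ∈ F, T.Incomparable T' ∧ T.IsMinSeparation T' Z := by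
  induction k with
  | zero => exact hZ.elim
  | succ k ih =>
    rcases hZ with hZ | ⟨hk, T, hT, T', hT', h, hZ⟩
    · exact ⟨by have := (ih hZ).1; push_cast; omega, (ih hZ).2⟩
    · exact ⟨by push_cast; omega, T, hT, T', hT', h, hZ.1.1⟩

theorem nestedBelow_nested [Finite U] {k : ℕ} (hX : X ∈ nestedBelow F k)
    (hY : Y ∈ nestedBelow F k) : NestedSets X Y := by
  induction k with
  | zero => exact hX.elim
  | succ k ih =>
    rcases hX with hX | ⟨hk, T, -, T', -, -, hX⟩
    · rcases hY with hY | ⟨-, T, -, T', -, -, hY⟩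
      · exact ih hX hY
      · exact (hY.1.2 X hX).symm
    · rcases hY with hY | ⟨hk', R, -, R', -, -, hY⟩
      · exact hX.1.2 Y hY
      · exact hX.nestedSets hY (hk.trans hk'.symm)

theorem nestedBelow_compl {k : ℕ} (hX : X ∈ nestedBelow F k) : Xᶜ ∈ nestedBelow F k := by
  induction k with
  | zero => exact hX.elim
  | succ k ih =>
    rcases hX with hX | ⟨hk, T, hT, T', hT', h, hX⟩
    · exact Or.inl (ih hX)
    · exact Or.inr ⟨by rw [κ.symmetric, hk], T', hT', T, hT, h.symm, hX.symm⟩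

theorem nestedBelow_mono : Monotone (nestedBelow F) :=
  monotone_nat_of_le_succ fun _ => Set.subset_union_left

/-- The canonical nested set of separations for a family of tangles. -/
def canonicalNested (F : Set (Tangle κ)) : Set (Set U) := ⋃ k, nestedBelow F k

theorem isNestedSetForIncomparable_canonicalNested [Finite U] (F : Set (Tangle κ)) :
    IsNestedSetForIncomparable F (canonicalNested F) where
  nested X hX Y hY := by
    obtain ⟨i, hi⟩ := Set.mem_iUnion.1 hX
    obtain ⟨j, hj⟩ := Set.mem_iUnion.1 hY
    exact nestedBelow_nested (nestedBelow_mono (le_max_left i j) hi)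
      (nestedBelow_mono (le_max_right i j) hj)
  compl_mem X hX := by
    obtain ⟨i, hi⟩ := Set.mem_iUnion.1 hX
    exact Set.mem_iUnion.2 ⟨i, nestedBelow_compl hi⟩
  exists_min_separation T hT T' hT' h := by
    obtain ⟨X, hX⟩ := h.exists_isMinSeparation
    obtain ⟨k, hk⟩ := Int.eq_ofNat_of_zero_le (κ.nonneg X)
    obtain ⟨Y, hY⟩ := hX.exists_isMinSeparationNested (N := nestedBelow F k)
      (fun Y hY Z hZ => nestedBelow_nested hY hZ) fun Y hY => by
        obtain ⟨hlt, R, -, R', -, -, hR⟩ := nestedBelow_spec hY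
        exact ⟨by omega, R, R', hR⟩
    obtain ⟨Z, hZ⟩ := hY.exists_isExtremeSeparation
    refine ⟨Z, Set.mem_iUnion.2 ⟨k + 1, Or.inr ⟨?_, T, hT, T', hT', h, hZ⟩⟩, hZ.1.1⟩
    -- `X` and `Z` are minimum for the same pair, so `Z` also has order `k` and enters at stage `k +
    -- 1`.
    have h1 := hX.2 Z hZ.1.1.1
    have h2 := hZ.1.1.2 X hX.1
    omega
  is_min_separation Z hZ := by
    obtain ⟨i, hi⟩ := Set.mem_iUnion.1 hZ
    exact (nestedBelow_spec hi).2

end Tangle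

/-! ### Invariance under isomorphism -/

section Transport

variable {U U' : Type*} {κ : ConnectivityFunction U} {κ' : ConnectivityFunction U'} {f : U ≃ U'}

namespace Tangle.MapsTo

variable {T R : Tangle κ} {T' R' : Tangle κ'} {Z : Set U}

theorem le_iff (hT : MapsTo f T T') (hR : MapsTo f R R') : T ≤ R ↔ T' ≤ R' := by
  refine and_congr ⟨fun h X hX => ?_, fun h X hX => ?_⟩ (by rw [hT.1, hR.1])
  · obtain ⟨Y, rfl⟩ := f.surjective.image_surjective X
    exact (hR.2 Y).1 (h ((hT.2 Y).2 hX))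
  · exact (hR.2 X).2 (h ((hT.2 X).1 hX))

theorem incomparable_iff (hT : MapsTo f T T') (hR : MapsTo f R R') :
    T.Incomparable R ↔ T'.Incomparable R' :=
  and_congr (hT.le_iff hR).not (hR.le_iff hT).not

theorem isSeparation_iff (hT : MapsTo f T T') (hR : MapsTo f R R') :
    T.IsSeparation R Z ↔ T'.IsSeparation R' (f '' Z) := by
  refine and_congr (hT.2 Z) ?_
  rw [hR.2, Set.image_compl_eq f.bijective]

theorem isMinSeparation_iff (hκ : ∀ X : Set U, κ X = κ' (f '' X)) (hT : MapsTo f T T')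
    (hR : MapsTo f R R') : T.IsMinSeparation R Z ↔ T'.IsMinSeparation R' (f '' Z) := by
  refine and_congr (hT.isSeparation_iff hR) ?_
  rw [f.surjective.image_surjective.forall]
  simp only [hT.isSeparation_iff hR, hκ]

theorem isMinSeparationNested_iff (hκ : ∀ X : Set U, κ X = κ' (f '' X)) (hT : MapsTo f T T')
    (hR : MapsTo f R R') {N : Set (Set U)} {N' : Set (Set U')}
    (hN : ∀ X, X ∈ N ↔ f '' X ∈ N') :
    IsMinSeparationNested N T R Z ↔ IsMinSeparationNested N' T' R' (f '' Z) := by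
  refine and_congr (hT.isMinSeparation_iff hκ hR) ?_
  rw [f.surjective.image_surjective.forall]
  simp only [hN, NestedSets.image_iff]

theorem isExtremeSeparation_iff (hκ : ∀ X : Set U, κ X = κ' (f '' X)) (hT : MapsTo f T T')
    (hR : MapsTo f R R') {N : Set (Set U)} {N' : Set (Set U')}
    (hN : ∀ X, X ∈ N ↔ f '' X ∈ N') :
    IsExtremeSeparation N T R Z ↔ IsExtremeSeparation N' T' R' (f '' Z) := by
  refine and_congr (hT.isMinSeparationNested_iff hκ hR hN) ?_
  rw [f.surjective.image_surjective.forall]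
  simp only [hT.isMinSeparationNested_iff hκ hR hN, sepWeight_image]

end Tangle.MapsTo

namespace IsTangleFamilyIso

variable {F : Set (Tangle κ)} {F' : Set (Tangle κ')}

theorem maximal (h : IsTangleFamilyIso f F F') :
    IsTangleFamilyIso f {T | Maximal (fun T' => T' ∈ F) T}
      {T | Maximal (fun T' => T' ∈ F') T} where
  map_conn := h.map_conn
  forth T hT := by
    obtain ⟨T', hT', hTT'⟩ := h.forth T hT.1
    refine ⟨T', ⟨hT', fun R' hR' hle => ?_⟩, hTT'⟩
    obtain ⟨R, hR, hRR'⟩ := h.back R' hR'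
    exact (hRR'.le_iff hTT').1 (hT.2 hR ((hTT'.le_iff hRR').2 hle))
  back T' hT' := by
    obtain ⟨T, hT, hTT'⟩ := h.back T' hT'.1
    refine ⟨T, ⟨hT, fun R hR hle => ?_⟩, hTT'⟩
    obtain ⟨R', hR', hRR'⟩ := h.forth R hR
    exact (hRR'.le_iff hTT').2 (hT'.2 hR' ((hTT'.le_iff hRR').1 hle))

theorem mem_nestedBelow_iff (h : IsTangleFamilyIso f F F') (k : ℕ) (Z : Set U) :
    Z ∈ Tangle.nestedBelow F k ↔ f '' Z ∈ Tangle.nestedBelow F' k := by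
  induction k generalizing Z with
  | zero => exact Iff.rfl
  | succ k ih =>
    refine or_congr (ih Z) (and_congr (by rw [h.map_conn]) ⟨?_, ?_⟩)
    · rintro ⟨T, hT, R, hR, hTR, hZ⟩
      obtain ⟨T', hT', m⟩ := h.forth T hT
      obtain ⟨R', hR', n⟩ := h.forth R hR
      exact ⟨T', hT', R', hR', (m.incomparable_iff n).1 hTR,
        (m.isExtremeSeparation_iff h.map_conn n ih).1 hZ⟩
    · rintro ⟨T', hT', R', hR', hTR, hZ⟩
      obtain ⟨T, hT, m⟩ := h.back T' hT'
      obtain ⟨R, hR, n⟩ := h.back R' hR'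
      exact ⟨T, hT, R, hR, (m.incomparable_iff n).2 hTR,
        (m.isExtremeSeparation_iff h.map_conn n ih).2 hZ⟩

theorem mem_canonicalNested_iff (h : IsTangleFamilyIso f F F') (Z : Set U) :
    Z ∈ Tangle.canonicalNested F ↔ f '' Z ∈ Tangle.canonicalNested F' := by
  simp only [Tangle.canonicalNested, Set.mem_iUnion, h.mem_nestedBelow_iff]

end IsTangleFamilyIso

end Transport

theorem mainTheorem3 :
    ∃ A : ∀ (U : Type u) [Finite U] (κ : ConnectivityFunction U), Set (Tangle κ) → Set (Set U),
      (∀ (U : Type u) [Finite U] (κ : ConnectivityFunction U) (F : Set (Tangle κ)),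
        F.Finite → IsNestedSetOfSeparations F (A U κ F)) ∧
      (∀ (U U' : Type u) [Finite U] [Finite U'] (κ : ConnectivityFunction U)
        (κ' : ConnectivityFunction U') (F : Set (Tangle κ)) (F' : Set (Tangle κ')),
        F.Finite → F'.Finite → ∀ f : U ≃ U', IsTangleFamilyIso f F F' →
          ∀ Z : Set U, Z ∈ A U κ F ↔ f '' Z ∈ A U' κ' F') :=
  ⟨fun _ _ _ F => Tangle.canonicalNested {T | Maximal (fun T' => T' ∈ F) T},
    fun _ _ _ _ _ => Tangle.isNestedSetForIncomparable_canonicalNested _,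
    fun _ _ _ _ _ _ _ _ _ _ _ h Z => h.maximal.mem_canonicalNested_iff Z⟩
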